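/- A Steiner quadruple system is a finite set $V$ together with a family of 4-element subsets of $V$ (blocks) such that every 3-element subset of $V$ is contained in exactly one block. A quadrilateral is a simple (not self-intersecting) planar polygon in $\mathbb{R}^3$ with four distinct corners, not necessarily convex; it is considered as a filled region, and a straight angle at a corner is allowed. A non-crossing drawing by quadrilaterals assigns distinct points of $\mathbb{R}^3$ to the elements of $V$ and to each block a quadrilateral whose corners are the four points of the block, such that the open filled quadrilaterals (boundary not included) of distinct blocks are disjoint, and no closed filled quadrilateral contains a corner of another one except at a corner of its own. Theorem. No Steiner quadruple system with more than $4$ vertices has a non-crossing drawing in which all quadrilaterals are convex. No Steiner quadruple system with at least $20$ vertices has a non-crossing drawing by arbitrary (convex or non-convex) quadrilaterals. -/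

import Mathlib

/-- Three-dimensional Euclidean space. -/
abbrev Space3 : Type := EuclideanSpace ℝ (Fin 3)

/-- `B` is the set of blocks of a Steiner system `S(t, k, n)` on the finite set `V` of
`n = Fintype.card V` points: every block has `k` elements, and every `t`-element subset of `V`
is contained in exactly one block. -/
def IsSteinerSystem {V : Type*} (t k : ℕ) (B : Set (Finset V)) : Prop :=
  (∀ b ∈ B, b.card = k) ∧ ∀ T : Finset V, T.card = t → ∃! b : Finset V, b ∈ B ∧ T ⊆ b

namespace Polygon

/-- A simple planar polygon in space, given by the cyclic sequence of its corners: the corners are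
distinct and lie in a common plane, and two different sides have no point in common except for a
common end point. Corners with a straight angle are allowed. -/
structure IsSimplePlanar {n : ℕ} (P : Polygon Space3 n) : Prop where
  injective : Function.Injective P.vertices
  coplanar : Coplanar ℝ (Set.range P.vertices)
  sides : ∀ i j : Fin n, i ≠ j →
    P.edgeSet ℝ i ∩ P.edgeSet ℝ j ⊆
      ({P i, P (finRotate n i)} : Set Space3) ∩ {P j, P (finRotate n j)}

/-- The supporting plane of a polygon, with the boundary curve of the polygon removed. -/
def planeComplement {n : ℕ} (P : Polygon Space3 n) : Set Space3 :=
  (affineSpan ℝ (Set.range P.vertices) : Set Space3) \ P.boundary ℝ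

/-- The open filled polygon: the points of the supporting plane that are enclosed by the boundary
curve, that is, whose connected component in the complement of the curve is bounded. -/
def openRegion {n : ℕ} (P : Polygon Space3 n) : Set Space3 :=
  {x | x ∈ P.planeComplement ∧ Bornology.IsBounded (connectedComponentIn P.planeComplement x)}

/-- The closed filled polygon: the open one together with its boundary curve. -/
def closedRegion {n : ℕ} (P : Polygon Space3 n) : Set Space3 :=
  P.openRegion ∪ P.boundary ℝ

/-- A polygon is convex if the closed region that it fills is convex. -/
def IsConvex {n : ℕ} (P : Polygon Space3 n) : Prop :=
  Convex ℝ P.closedRegion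

end Polygon

/-- A non-crossing drawing in space, by `k`-gons, of the hypergraph with vertex set `V` and edge
set `E`. Distinct vertices are represented by distinct points `pos v`, and every edge `e` by a
simple planar polygon `poly e` whose corners are the points of the vertices in `e`. The open filled
polygons of different edges are disjoint, and a closed filled polygon contains a corner of another
polygon only at a corner of its own. The values of `poly` outside `E` are irrelevant. -/
structure IsNoncrossingDrawing {V : Type*} {k : ℕ} (E : Set (Finset V))
    (pos : V → Space3) (poly : Finset V → Polygon Space3 k) : Prop where
  pos_injective : Function.Injective pos
  simple : ∀ e ∈ E, (poly e).IsSimplePlanar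
  corners : ∀ e ∈ E, Set.range (poly e).vertices = pos '' (e : Set V)
  disjoint : ∀ e ∈ E, ∀ f ∈ E, e ≠ f → Disjoint (poly e).openRegion (poly f).openRegion
  corner_mem : ∀ e ∈ E, ∀ f ∈ E, ∀ v ∈ f, pos v ∈ (poly e).closedRegion → v ∈ e

/-! Every simple planar quadrilateral has an inner diagonal, one whose midpoint lies in the open
region (`IsSimplePlanar.exists_midpoint_mem_openRegion`). Open regions of distinct blocks are
disjoint, so distinct blocks have distinct inner diagonals, and there are at most C(n,2) blocks. A
quadruple system has C(n,3)/4 blocks, which forces n ≤ 14.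

In a convex drawing with n > 4 no three points are collinear (`not_collinear_of_isConvex`), so both
diagonals of each block are inner. Take an edge uv of the convex hull of all points
(`exists_supporting_edge`). The blocks through u have distinct diagonals at u, and none of these is
uv, since an inner diagonal cannot lie in a supporting plane that misses some corner. Hence
(n-1)(n-2)/6 ≤ n-2, so n ≤ 7, and divisibility excludes n = 5, 6, 7. -/

open Set

/-! ### Quadrilaterals: a separating diagonal is inner. -/

namespace Polygon

theorem mem_boundary_iff {P : Polygon Space3 4} {z : Space3} (i : Fin 4) :
    z ∈ P.boundary ℝ ↔ z ∈ segment ℝ (P i) (P (i + 1)) ∨ z ∈ segment ℝ (P (i + 1)) (P (i + 2)) ∨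
      z ∈ segment ℝ (P (i + 2)) (P (i + 3)) ∨ z ∈ segment ℝ (P (i + 3)) (P i) := by
  have h4 : ∀ i j : Fin 4, j = i ∨ j = i + 1 ∨ j = i + 2 ∨ j = i + 3 := by decide
  have h1 : i + 1 + 1 = i + 2 := by revert i; decide
  have h2 : i + 2 + 1 = i + 3 := by revert i; decide
  have h3 : i + 3 + 1 = i := by revert i; decide
  simp only [boundary, edgeSet, finRotate_apply, affineSegment_eq_segment, mem_iUnion]
  constructor
  · rintro ⟨j, hj⟩
    rcases h4 i j with rfl | rfl | rfl | rfl
    · exact Or.inl hj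
    · exact Or.inr (Or.inl (by rwa [h1] at hj))
    · exact Or.inr (Or.inr (Or.inl (by rwa [h2] at hj)))
    · exact Or.inr (Or.inr (Or.inr (by rwa [h3] at hj)))
  · rintro (h | h | h | h)
    · exact ⟨i, h⟩
    · exact ⟨i + 1, by rwa [h1]⟩
    · exact ⟨i + 2, by rwa [h2]⟩
    · exact ⟨i + 3, by rwa [h3]⟩

theorem range_vertices {P : Polygon Space3 4} (i : Fin 4) :
    range P.vertices = {P i, P (i + 1), P (i + 2), P (i + 3)} := by
  have h4 : ∀ i j : Fin 4, j = i ∨ j = i + 1 ∨ j = i + 2 ∨ j = i + 3 := by decide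
  ext z
  simp only [mem_range, mem_insert_iff, mem_singleton_iff]
  constructor
  · rintro ⟨j, rfl⟩
    rcases h4 i j with rfl | rfl | rfl | rfl <;> simp
  · rintro (rfl | rfl | rfl | rfl) <;> exact ⟨_, rfl⟩

theorem mem_boundary_vertex (P : Polygon Space3 4) (i : Fin 4) : P i ∈ P.boundary ℝ :=
  (mem_boundary_iff i).2 (Or.inl (left_mem_segment ℝ _ _))

theorem exists_dual_pair {v w : Space3} (h : LinearIndependent ℝ ![v, w]) :
    ∃ X Y : Space3 →ₗ[ℝ] ℝ, X v = 1 ∧ X w = 0 ∧ Y v = 0 ∧ Y w = 1 := by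
  have key : ∀ v w : Space3, LinearIndependent ℝ ![v, w] →
      ∃ X : Space3 →ₗ[ℝ] ℝ, X v = 1 ∧ X w = 0 := by
    intro v w h
    have hv : v ∉ Submodule.span ℝ {w} := by
      rw [Submodule.mem_span_singleton]
      rintro ⟨r, hr⟩
      have := (LinearIndependent.pair_iff.1 h) 1 (-r) (by simp [hr])
      simp at this
    obtain ⟨f, hf, hf'⟩ := Submodule.exists_dual_map_eq_bot_of_notMem hv inferInstance
    refine ⟨(f v)⁻¹ • f, by simp [hf], ?_⟩
    have : f w ∈ (Submodule.span ℝ {w}).map f :=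
      Submodule.mem_map_of_mem (Submodule.mem_span_singleton_self w)
    rw [hf', Submodule.mem_bot] at this
    simp [this]
  obtain ⟨X, hX⟩ := key v w h
  obtain ⟨Y, hY⟩ := key w v (by rwa [LinearIndependent.pair_symm_iff] at h)
  exact ⟨X, Y, hX.1, hX.2, hY.2, hY.1⟩

/-- If a diagonal of a planar quadrilateral strictly separates the two other corners, then the
midpoint of the diagonal lies in the open filled quadrilateral. -/
theorem midpoint_mem_openRegion {P : Polygon Space3 4} (i : Fin 4) {p q : ℝ}
    (hli : LinearIndependent ℝ ![P (i + 2) - P i, P (i + 1) - P i]) (hq : q < 0)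
    (hd : P (i + 3) = P i + p • (P (i + 2) - P i) + q • (P (i + 1) - P i)) :
    midpoint ℝ (P i) (P (i + 2)) ∈ P.openRegion := by
  obtain ⟨X, Y, hXv, hXw, hYv, hYw⟩ := exists_dual_pair hli
  have hXc : Continuous X := X.continuous_of_finiteDimensional
  have hYc : Continuous Y := Y.continuous_of_finiteDimensional
  have hrange := range_vertices (P := P) i
  have hbd := fun z => mem_boundary_iff (P := P) (z := z) i
  set a := P i
  obtain ⟨v, hv⟩ : ∃ v, v = P (i + 2) - a := ⟨_, rfl⟩
  obtain ⟨w, hw⟩ : ∃ w, w = P (i + 1) - a := ⟨_, rfl⟩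
  have hc : P (i + 2) = a + v := by rw [hv]; abel
  have hb : P (i + 1) = a + w := by rw [hw]; abel
  rw [← hv, ← hw] at hd
  rw [← hv] at hXv hYv
  rw [← hw] at hXw hYw
  rw [hb, hc, hd] at hrange
  simp only [hb, hc, hd] at hbd
  rw [hc]
  have hm : midpoint ℝ a (a + v) = a + (1 / 2 : ℝ) • v + (0 : ℝ) • w := by
    rw [midpoint_eq_smul_add, invOf_eq_inv]
    module
  rw [hm]
  have hplane : ∀ z ∈ affineSpan ℝ (range P.vertices),
      z = a + X (z - a) • v + Y (z - a) • w := by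
    intro z hz
    have hle : affineSpan ℝ (range P.vertices) ≤
        AffineSubspace.mk' a (Submodule.span ℝ {v, w}) := by
      rw [affineSpan_le, hrange]
      intro z hz
      simp only [mem_insert_iff, mem_singleton_iff] at hz
      rw [SetLike.mem_coe, AffineSubspace.mem_mk', Submodule.mem_span_pair]
      rcases hz with rfl | rfl | rfl | rfl
      · exact ⟨0, 0, by simp⟩
      · exact ⟨0, 1, by simp⟩
      · exact ⟨1, 0, by simp⟩
      · exact ⟨p, q, by simp [add_assoc]⟩
    have := hle hz
    rw [AffineSubspace.mem_mk', Submodule.mem_span_pair, vsub_eq_sub] at this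
    obtain ⟨x, y, hxy⟩ := this
    have h1 : X (z - a) = x := by rw [← hxy]; simp [hXv, hXw]
    have h2 : Y (z - a) = y := by rw [← hxy]; simp [hYv, hYw]
    rw [h1, h2, add_assoc, hxy]; abel
  -- In the coordinates given by `X` and `Y` the corners are (0,0), (0,1), (1,0), (p,q). The lines
  -- carrying the sides at (0,0) give `l`, those carrying the sides at (1,0) give `r`; the two
  -- graphs meet at the heights q and 1.
  set l : ℝ → ℝ := fun y => if y ≤ 0 then y / q * p else 0 with hl
  set r : ℝ → ℝ := fun y => if y ≤ 0 then 1 - y / q + y / q * p else 1 - y with hr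
  have hlc : Continuous l := by
    refine Continuous.if_le (by fun_prop) (by fun_prop) (by fun_prop) (by fun_prop) ?_
    rintro y rfl; simp
  have hrc : Continuous r := by
    refine Continuous.if_le (by fun_prop) (by fun_prop) (by fun_prop) (by fun_prop) ?_
    rintro y rfl; simp
  let x' : Space3 → ℝ := fun z => X (z - a)
  let y' : Space3 → ℝ := fun z => Y (z - a)
  have hx'c : Continuous x' := hXc.comp (by fun_prop)
  have hy'c : Continuous y' := hYc.comp (by fun_prop)
  let U : Set Space3 := {z | l (y' z) < x' z ∧ x' z < r (y' z)}
  -- The clause `r < l` covers the heights outside [q, 1]. In the plane, what `U` and `W` leave out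
  -- is contained in the boundary curve, so the component of the midpoint stays in the bounded set
  -- `U`.
  let W : Set Space3 := {z | x' z < l (y' z) ∨ r (y' z) < x' z ∨ r (y' z) < l (y' z)}
  have hUo : IsOpen U :=
    (isOpen_lt (hlc.comp hy'c) hx'c).inter (isOpen_lt hx'c (hrc.comp hy'c))
  have hWo : IsOpen W :=
    (isOpen_lt hx'c (hlc.comp hy'c)).union ((isOpen_lt (hrc.comp hy'c) hx'c).union
      (isOpen_lt (hrc.comp hy'c) (hlc.comp hy'c)))
  have hUW : Disjoint U W := by
    rw [Set.disjoint_left]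
    rintro z ⟨h1, h2⟩ (h | h | h) <;> linarith
  have hcover : P.planeComplement ⊆ U ∪ W := by
    rintro z ⟨hz, hzb⟩
    by_contra hcon
    simp only [U, W, mem_union, mem_ofPred_eq, not_or, not_and, not_lt] at hcon
    obtain ⟨h1, h2, h3, h4⟩ := hcon
    apply hzb
    rw [hbd]
    have hz' : z = a + x' z • v + y' z • w := hplane z hz
    generalize x' z = x at *
    generalize y' z = y at *
    have h5 : l y = x ∨ r y = x := by
      by_cases h : l y < x
      · right; exact le_antisymm (h1 h) h3
      · left; linarith
    simp only [hl, hr] at h2 h3 h4 h5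
    by_cases hy : y ≤ 0
    · simp only [if_pos hy] at h2 h3 h4 h5
      have ht0 : 0 ≤ y / q := div_nonneg_of_nonpos hy hq.le
      have hyt : y = y / q * q := (div_mul_cancel₀ y hq.ne).symm
      have ht1 : y / q ≤ 1 := by linarith
      generalize y / q = t at *
      subst hyt
      rcases h5 with h5 | h5
      · refine Or.inr (Or.inr (Or.inr ⟨t, 1 - t, ht0, by linarith, by ring, ?_⟩))
        rw [hz', ← h5]; module
      · refine Or.inr (Or.inr (Or.inl ⟨1 - t, t, by linarith, ht0, by ring, ?_⟩))
        rw [hz', ← h5]; module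
    · simp only [if_neg hy] at h2 h3 h4 h5
      push Not at hy
      rcases h5 with h5 | h5
      · refine Or.inl ⟨1 - y, y, by linarith, by linarith, by ring, ?_⟩
        rw [hz', ← h5]; module
      · refine Or.inr (Or.inl ⟨y, 1 - y, by linarith, by linarith, by ring, ?_⟩)
        rw [hz', ← h5]; module
  set m := a + (1 / 2 : ℝ) • v + (0 : ℝ) • w with hmdef
  have hxm : x' m = 1 / 2 := by simp [x', hmdef, hXv]
  have hym : y' m = 0 := by simp [y', hmdef, hYv]
  have hmU : m ∈ U := by
    simp only [U, mem_ofPred_eq, hxm, hym, hl, hr]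
    norm_num
  have hmK : m ∈ P.planeComplement := by
    refine ⟨?_, ?_⟩
    · rw [SetLike.mem_coe, ← hm]
      apply AffineMap.lineMap_mem _ <;> apply subset_affineSpan <;> rw [hrange] <;> simp
    · rw [hbd]
      rintro (⟨s, t, hs, ht, hst, h⟩ | ⟨s, t, hs, ht, hst, h⟩ | ⟨s, t, hs, ht, hst, h⟩ |
        ⟨s, t, hs, ht, hst, h⟩)
      all_goals
        have hX := congrArg x' h
        have hY := congrArg y' h
        rw [hxm] at hX
        rw [hym] at hY
        simp only [x', y', map_sub, map_add, map_smul, hXv, hXw, hYv, hYw, smul_eq_mul] at hX hY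
      · obtain rfl : s = 1 - t := by linarith
        linarith
      · obtain rfl : s = 1 - t := by linarith
        nlinarith
      · obtain rfl : s = 1 - t := by linarith
        have : t * q = 0 := by linarith
        have : t = 0 := by simpa [hq.ne] using this
        subst this
        linarith
      · obtain rfl : t = 1 - s := by linarith
        have : s * q = 0 := by linarith
        have : s = 0 := by simpa [hq.ne] using this
        subst this
        linarith
  refine ⟨hmK, ?_⟩
  have hsub : connectedComponentIn P.planeComplement m ⊆ U :=
    isPreconnected_connectedComponentIn.subset_left_of_subset_union hUo hWo hUW
      ((connectedComponentIn_subset _ _).trans hcover)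
      ⟨m, mem_connectedComponentIn hmK, hmU⟩
  let g : ℝ × ℝ → Space3 := fun t => a + t.1 • v + t.2 • w
  have hg : Continuous g := by fun_prop
  have hcomp : IsCompact (g '' (Icc (-|p|) (1 + |p|) ×ˢ Icc q 1)) :=
    (isCompact_Icc.prod isCompact_Icc).image hg
  refine hcomp.isBounded.subset fun z hz => ?_
  have hzU := hsub hz
  refine ⟨(x' z, y' z), ?_, (hplane z (connectedComponentIn_subset _ _ hz).1).symm⟩
  simp only [U, mem_ofPred_eq] at hzU
  generalize x' z = x at *
  generalize y' z = y at *
  obtain ⟨h1, h2⟩ := hzU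
  simp only [hl, hr] at h1 h2
  simp only [mem_prod, mem_Icc]
  by_cases hy : y ≤ 0
  · simp only [if_pos hy] at h1 h2
    have ht0 : 0 ≤ y / q := div_nonneg_of_nonpos hy hq.le
    have hyt : y = y / q * q := (div_mul_cancel₀ y hq.ne).symm
    have ht1 : y / q ≤ 1 := by linarith
    generalize y / q = t at *
    have h6 : |t * p| ≤ |p| := by
      rw [abs_mul, abs_of_nonneg ht0]
      exact mul_le_of_le_one_left (abs_nonneg _) ht1
    have := abs_le.1 h6
    refine ⟨⟨by linarith, by linarith⟩, ?_, by linarith⟩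
    rw [hyt]; nlinarith
  · simp only [if_neg hy] at h1 h2
    have := abs_nonneg p
    push Not at hy
    exact ⟨⟨by linarith, by linarith⟩, by linarith, by linarith⟩

end Polygon

/-! ### Simple quadrilaterals: existence of an inner diagonal. -/

theorem add_smul_mem_segment (a v : Space3) {x y z : ℝ} (hy : y ≤ x) (hz : x ≤ z) :
    a + x • v ∈ segment ℝ (a + y • v) (a + z • v) := by
  have : x ∈ segment ℝ y z := by
    rw [segment_eq_Icc (hy.trans hz)]
    exact ⟨hy, hz⟩
  obtain ⟨s, t, hs, ht, hst, rfl⟩ := this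
  refine ⟨s, t, hs, ht, hst, ?_⟩
  obtain rfl : s = 1 - t := by linarith
  simp only [smul_eq_mul]
  module

namespace Polygon

theorem IsSimplePlanar.vertex_mem_segment {P : Polygon Space3 4} (h : P.IsSimplePlanar)
    {k j : Fin 4} (hk : P k ∈ segment ℝ (P j) (P (j + 1))) : k = j ∨ k = j + 1 := by
  by_contra! hne
  have h1 : P k ∈ P.edgeSet ℝ j := by
    rw [edgeSet, affineSegment_eq_segment, finRotate_apply]
    exact hk
  have h2 : P k ∈ P.edgeSet ℝ k := by
    rw [edgeSet, affineSegment_eq_segment]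
    exact left_mem_segment ℝ _ _
  have := (h.sides j k hne.1.symm ⟨h1, h2⟩).1
  rw [finRotate_apply] at this
  rcases this with h3 | h3
  · exact hne.1 (h.injective h3)
  · exact hne.2 (h.injective h3)

theorem IsSimplePlanar.disjoint_opposite {P : Polygon Space3 4} (h : P.IsSimplePlanar)
    (i : Fin 4) {z : Space3} (h1 : z ∈ segment ℝ (P i) (P (i + 1)))
    (h2 : z ∈ segment ℝ (P (i + 2)) (P (i + 3))) : False := by
  have hne : ∀ i : Fin 4, i ≠ i + 2 ∧ i ≠ i + 2 + 1 ∧ i + 1 ≠ i + 2 ∧ i + 1 ≠ i + 2 + 1 ∧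
    i + 3 = i + 2 + 1 := by decide
  obtain ⟨n1, n2, n3, n4, e⟩ := hne i
  rw [e] at h2
  have := h.sides i (i + 2) n1
    ⟨by rwa [edgeSet, affineSegment_eq_segment, finRotate_apply],
      by rwa [edgeSet, affineSegment_eq_segment, finRotate_apply]⟩
  rw [finRotate_apply, finRotate_apply] at this
  obtain ⟨rfl | rfl, h3 | h3⟩ := this
  · exact n1 (h.injective h3)
  · exact n2 (h.injective h3)
  · exact n3 (h.injective h3)
  · exact n4 (h.injective h3)

/-- Otherwise, dividing the dependency by α + β exhibits a Radon point common to two opposite sides.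
-/
theorem IsSimplePlanar.eq_zero_of_signs {P : Polygon Space3 4} (h : P.IsSimplePlanar)
    (i : Fin 4) {α β γ δ : ℝ} (hs : α + β + γ + δ = 0)
    (hd : α • P i + β • P (i + 1) + γ • P (i + 2) + δ • P (i + 3) = 0)
    (hα : 0 ≤ α) (hβ : 0 ≤ β) (hγ : γ ≤ 0) (hδ : δ ≤ 0) : α + β = 0 := by
  by_contra hne
  have hpos : 0 < α + β := lt_of_le_of_ne (by positivity) (Ne.symm hne)
  refine h.disjoint_opposite i
    (z := (α / (α + β)) • P i + (β / (α + β)) • P (i + 1))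
    ⟨_, _, by positivity, by positivity, by field_simp, rfl⟩
    ⟨-γ / (α + β), -δ / (α + β), div_nonneg (by linarith) hpos.le,
      div_nonneg (by linarith) hpos.le, by field_simp; linarith, ?_⟩
  have : (α + β)⁻¹ • (α • P i + β • P (i + 1) + γ • P (i + 2) + δ • P (i + 3)) = 0 := by
    rw [hd, smul_zero]
  rw [← sub_eq_zero, ← neg_eq_zero, ← this]
  module

theorem IsSimplePlanar.exists_weights {P : Polygon Space3 4} (h : P.IsSimplePlanar) :
    ∃ w : Fin 4 → ℝ, w ≠ 0 ∧ w 0 + w 1 + w 2 + w 3 = 0 ∧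
      w 0 • P 0 + w 1 • P 1 + w 2 • P 2 + w 3 • P 3 = 0 := by
  have hnot : ¬ AffineIndependent ℝ P.vertices := by
    rw [affineIndependent_iff_finrank_vectorSpan_eq ℝ P.vertices (n := 3) (by simp)]
    have := h.coplanar.finrank_le_two
    intro h3
    rw [h3] at this
    norm_num at this
  rw [affineIndependent_iff] at hnot
  push Not at hnot
  obtain ⟨s, w, hw, hwp, i, hi, hne⟩ := hnot
  have e1 : ∀ j, (s : Set (Fin 4)).indicator w j = if j ∈ s then w j else 0 := by
    intro j; simp [indicator]
  refine ⟨(s : Set (Fin 4)).indicator w, fun h0 => hne ?_, ?_, ?_⟩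
  · have := congrFun h0 i
    simpa [hi] using this
  · rw [← Fin.sum_univ_four, ← hw]
    simp [e1]
  · rw [← Fin.sum_univ_four (fun j => (s : Set (Fin 4)).indicator w j • P j), ← hwp]
    simp [e1]

/-- In an affine dependency of the corners, if neither opposite pair had weights of the same strict
sign, some two adjacent weights would be ≥ 0 and the other two ≤ 0, and `eq_zero_of_signs` would
kill them all. A pair with equal signs lies on opposite sides of the line through the other two
corners, or on that line. -/
theorem IsSimplePlanar.exists_separating {P : Polygon Space3 4} (h : P.IsSimplePlanar) :
    ∃ (j : Fin 4) (α β γ δ : ℝ), 0 < β * δ ∧ α + β + γ + δ = 0 ∧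
      α • P j + β • P (j + 1) + γ • P (j + 2) + δ • P (j + 3) = 0 := by
  obtain ⟨w, hw0, hs, hd⟩ := h.exists_weights
  by_contra! hcon
  have h1 : w 1 * w 3 ≤ 0 := by
    by_contra! hpos
    exact hcon 0 _ _ _ _ hpos hs hd
  have h0 : w 0 * w 2 ≤ 0 := by
    by_contra! hpos
    refine hcon 3 (w 3) (w 0) (w 1) (w 2) hpos (by linarith) ?_
    change w 3 • P 3 + w 0 • P 0 + w 1 • P 1 + w 2 • P 2 = 0
    rw [← hd]; abel
  have key : w 0 = 0 ∧ w 1 = 0 ∧ w 2 = 0 ∧ w 3 = 0 := by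
    rcases mul_nonpos_iff.1 h0 with ⟨a, c⟩ | ⟨a, c⟩ <;>
      rcases mul_nonpos_iff.1 h1 with ⟨b, d⟩ | ⟨b, d⟩
    · have := h.eq_zero_of_signs 0 hs hd a b c d
      refine ⟨?_, ?_, ?_, ?_⟩ <;> linarith
    · have := h.eq_zero_of_signs 3 (α := w 3) (β := w 0) (γ := w 1) (δ := w 2) (by linarith)
        (by change w 3 • P 3 + w 0 • P 0 + w 1 • P 1 + w 2 • P 2 = 0
            rw [← hd]; abel) d a b c
      refine ⟨?_, ?_, ?_, ?_⟩ <;> linarith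
    · have := h.eq_zero_of_signs 1 (α := w 1) (β := w 2) (γ := w 3) (δ := w 0) (by linarith)
        (by change w 1 • P 1 + w 2 • P 2 + w 3 • P 3 + w 0 • P 0 = 0
            rw [← hd]; abel) b c d a
      refine ⟨?_, ?_, ?_, ?_⟩ <;> linarith
    · have := h.eq_zero_of_signs 2 (α := w 2) (β := w 3) (γ := w 0) (δ := w 1) (by linarith)
        (by change w 2 • P 2 + w 3 • P 3 + w 0 • P 0 + w 1 • P 1 = 0
            rw [← hd]; abel) c d a b
      refine ⟨?_, ?_, ?_, ?_⟩ <;> linarith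
  apply hw0
  funext j
  fin_cases j <;> simp [key]

/-- With corners j and j + 2 at parameters 0 and 1, both neighbours of j + 2 must have parameter
below 1. The one nearer to 1 then lies on the side joining j + 2 to the other. -/
theorem IsSimplePlanar.not_on_line {P : Polygon Space3 4} (h : P.IsSimplePlanar) (j : Fin 4)
    {s t : ℝ} (hb : P (j + 1) = P j + t • (P (j + 2) - P j))
    (hd : P (j + 3) = P j + s • (P (j + 2) - P j)) : False := by
  have hj : ∀ j : Fin 4, (j ≠ j + 1 ∧ j ≠ j + 2 ∧ j ≠ j + 3) ∧
    (j + 1 ≠ j + 2 ∧ j + 1 ≠ j + 3) ∧ j + 2 ≠ j + 3 := by decide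
  obtain ⟨⟨n1, n2, n3⟩, ⟨n4, n5⟩, n6⟩ := hj j
  have he : ∀ j : Fin 4, j + 1 + 1 = j + 2 ∧ j + 2 + 1 = j + 3 ∧ j + 3 + 1 = j := by decide
  obtain ⟨e1, e2, e3⟩ := he j
  have q2 := fun k => h.vertex_mem_segment (k := k) (j := j + 1)
  have q3 := fun k => h.vertex_mem_segment (k := k) (j := j + 2)
  have q4 := fun k => h.vertex_mem_segment (k := k) (j := j + 3)
  rw [e1] at q2
  rw [e2] at q3
  rw [e3] at q4
  have m1 : P (j + 2) ∉ segment ℝ (P j) (P (j + 1)) := fun hm =>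
    (h.vertex_mem_segment hm).elim n2.symm n4.symm
  have m3 : P (j + 2) ∉ segment ℝ (P (j + 3)) (P j) := fun hm => (q4 _ hm).elim n6 n2.symm
  have m4 : P (j + 1) ∉ segment ℝ (P (j + 2)) (P (j + 3)) := fun hm => (q3 _ hm).elim n4 n5
  have m5 : P (j + 3) ∉ segment ℝ (P (j + 1)) (P (j + 2)) := fun hm =>
    (q2 _ hm).elim n5.symm n6.symm
  clear q2 q3 q4
  generalize P (j + 1) = b at *
  generalize P (j + 3) = d at *
  generalize P (j + 2) = c at *
  generalize P j = a at *
  obtain ⟨v, rfl⟩ : ∃ v, c = a + v := ⟨c - a, by abel⟩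
  rw [add_sub_cancel_left] at hb hd
  subst hb hd
  have seg := fun x y z : ℝ => add_smul_mem_segment a v (x := x) (y := y) (z := z)
  have t1 : t < 1 := by
    by_contra! ht
    have := seg 1 0 t zero_le_one ht
    rw [one_smul, zero_smul, add_zero] at this
    exact m1 this
  have s1 : s < 1 := by
    by_contra! ht
    have := seg 1 0 s zero_le_one ht
    rw [one_smul, zero_smul, add_zero, segment_symm] at this
    exact m3 this
  rcases le_total s t with hst | hst
  · have := seg t s 1 hst t1.le
    rw [one_smul, segment_symm] at this
    exact m4 this
  · have := seg s t 1 hst s1.le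
    rw [one_smul] at this
    exact m5 this

/-- Every simple planar quadrilateral has an inner diagonal. -/
theorem IsSimplePlanar.exists_midpoint_mem_openRegion {P : Polygon Space3 4}
    (h : P.IsSimplePlanar) : ∃ i : Fin 4, midpoint ℝ (P i) (P (i + 2)) ∈ P.openRegion := by
  obtain ⟨j, α, β, γ, δ, hpos, hs, hd⟩ := h.exists_separating
  have hδ : δ ≠ 0 := by rintro rfl; simp at hpos
  have hq : -β / δ < 0 := by
    rw [neg_div, neg_lt_zero]
    rcases pos_and_pos_or_neg_and_neg_of_mul_pos hpos with ⟨h1, h2⟩ | ⟨h1, h2⟩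
    · exact div_pos h1 h2
    · exact div_pos_of_neg_of_neg h1 h2
  have hd' : P (j + 3) = P j + (-γ / δ) • (P (j + 2) - P j) + (-β / δ) • (P (j + 1) - P j) := by
    obtain rfl : α = -β - γ - δ := by linarith
    have : δ⁻¹ • ((-β - γ - δ) • P j + β • P (j + 1) + γ • P (j + 2) + δ • P (j + 3)) = 0 := by
      rw [hd, smul_zero]
    rw [← sub_eq_zero, ← this]
    match_scalars <;> field_simp
    ring
  refine ⟨j, midpoint_mem_openRegion j ?_ hq hd'⟩
  have hne : P (j + 2) - P j ≠ 0 := by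
    rw [sub_ne_zero]
    intro h0
    have hj : ∀ j : Fin 4, j + 2 ≠ j := by decide
    exact hj j (h.injective h0)
  rw [LinearIndependent.pair_iff' hne]
  intro t ht
  -- If corner j + 1 is on the diagonal line, then `hd'` puts j + 3 there too.
  refine h.not_on_line j (t := t) (s := -γ / δ + -β / δ * t) (by rw [ht]; abel) ?_
  rw [hd', ← ht]
  module

/-! ### Supporting planes and convex quadrilaterals. -/

/-- A segment between two corners in a supporting hyperplane of a planar quadrilateral that does
not contain all its corners is not an inner diagonal. -/
theorem midpoint_notMem_openRegion {P : Polygon Space3 4} (g : Space3 →ₗ[ℝ] ℝ) {M : ℝ}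
    (hle : ∀ j, g (P j) ≤ M) {i k j : Fin 4} (hi : g (P i) = M) (hk : g (P k) = M)
    (hj : g (P j) < M) : midpoint ℝ (P i) (P k) ∉ P.openRegion := by
  rintro ⟨hm, hbdd⟩
  set m := midpoint ℝ (P i) (P k) with hmdef
  have hgm : g m = M := by
    rw [hmdef, midpoint_eq_smul_add, invOf_eq_inv, map_smul, map_add, hi, hk, smul_eq_mul]
    ring
  -- This ray stays in the plane of the polygon, and `g` exceeds M on it for t > 0. It therefore
  -- avoids the boundary, which makes the component of m unbounded.
  let ρ : ℝ → Space3 := fun t => m + t • (m - P j)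
  have hρ : Continuous ρ := by fun_prop
  have hgρ : ∀ t, g (ρ t) = M + t * (M - g (P j)) := by
    intro t
    simp [ρ, hgm]
  have hbound : ∀ z ∈ P.boundary ℝ, g z ≤ M := by
    intro z hz
    have seg : ∀ k l : Fin 4, z ∈ segment ℝ (P k) (P l) → g z ≤ M := by
      rintro k l ⟨s, t, hs, ht, hst, rfl⟩
      rw [map_add, map_smul, map_smul, smul_eq_mul, smul_eq_mul]
      calc s * g (P k) + t * g (P l) ≤ s * M + t * M := by gcongr <;> apply hle
        _ = M := by rw [← add_mul, hst, one_mul]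
    rcases (mem_boundary_iff 0).1 hz with h | h | h | h
    all_goals exact seg _ _ h
  have hsub : ρ '' Ici 0 ⊆ P.planeComplement := by
    rintro _ ⟨t, ht, rfl⟩
    rcases eq_or_lt_of_le (mem_Ici.1 ht) with rfl | ht
    · simpa [ρ] using hm
    · refine ⟨?_, fun hz => ?_⟩
      · have := AffineSubspace.smul_vsub_vadd_mem (affineSpan ℝ (range P.vertices)) t hm.1
          (subset_affineSpan ℝ _ (mem_range_self j)) hm.1
        simpa [ρ, add_comm] using this
      · have h1 := hbound _ hz
        rw [hgρ] at h1
        have : 0 < t * (M - g (P j)) := mul_pos ht (by linarith)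
        linarith
  have hcc : ρ '' Ici 0 ⊆ connectedComponentIn P.planeComplement m :=
    (isPreconnected_Ici.image ρ hρ.continuousOn).subset_connectedComponentIn
      ⟨0, by simp, by simp [ρ]⟩ hsub
  obtain ⟨C, hC⟩ := (hbdd.subset hcc).exists_norm_le
  let G := g.toContinuousLinearMap
  have hG : ∀ t, 0 ≤ t → M + t * (M - g (P j)) ≤ ‖G‖ * C := by
    intro t ht
    calc M + t * (M - g (P j)) = G (ρ t) := (hgρ t).symm
      _ ≤ ‖G (ρ t)‖ := Real.le_norm_self _
      _ ≤ ‖G‖ * ‖ρ t‖ := G.le_opNorm _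
      _ ≤ ‖G‖ * C := by gcongr; exact hC _ ⟨t, ht, rfl⟩
  have hpos : 0 < M - g (P j) := by linarith
  have h1 := hG ((|‖G‖ * C - M| + 1) / (M - g (P j))) (by positivity)
  rw [div_mul_cancel₀ _ hpos.ne'] at h1
  have := le_abs_self (‖G‖ * C - M)
  linarith

/-- Convexity puts the midpoint in the closed region. Every side ends at a corner of this diagonal,
so a midpoint on a side would make three corners collinear. -/
theorem IsConvex.midpoint_mem_openRegion {P : Polygon Space3 4} (h : P.IsConvex)
    (hcol : ∀ i j k : Fin 4, i ≠ j → j ≠ k → i ≠ k → ¬ Collinear ℝ {P i, P j, P k})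
    (i : Fin 4) : midpoint ℝ (P i) (P (i + 2)) ∈ P.openRegion := by
  have hm : midpoint ℝ (P i) (P (i + 2)) ∈ P.closedRegion :=
    h.midpoint_mem (Or.inr (mem_boundary_vertex P i)) (Or.inr (mem_boundary_vertex P (i + 2)))
  rcases hm with hm | hm
  · exact hm
  exfalso
  have key : ∀ a b c : Space3, midpoint ℝ a c ∈ segment ℝ a b →
      Collinear ℝ {a, b, c} := by
    intro a b c hm
    rw [collinear_iff_of_mem (p₀ := a) (by simp)]
    obtain ⟨s, t, hs, ht, hst, he⟩ := hm
    obtain rfl : s = 1 - t := by linarith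
    have hc : c = a + (2 * t) • (b - a) := by
      have : c = (2 : ℝ) • midpoint ℝ a c - a := by
        rw [midpoint_eq_smul_add, invOf_eq_inv]; module
      rw [this, ← he]; module
    refine ⟨b - a, fun p hp => ?_⟩
    simp only [mem_insert_iff, mem_singleton_iff] at hp
    rcases hp with rfl | rfl | rfl
    · exact ⟨0, by simp⟩
    · exact ⟨1, by simp⟩
    · exact ⟨2 * t, by rw [vadd_eq_add]; nth_rw 1 [hc]; abel⟩
  have hj : ∀ j : Fin 4, (j ≠ j + 1 ∧ j ≠ j + 2 ∧ j ≠ j + 3) ∧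
    (j + 1 ≠ j + 2 ∧ j + 1 ≠ j + 3) ∧ j + 2 ≠ j + 3 := by decide
  obtain ⟨⟨n1, n2, n3⟩, ⟨n4, n5⟩, n6⟩ := hj i
  rcases (mem_boundary_iff i).1 hm with h1 | h1 | h1 | h1
  · exact hcol _ _ _ n1 n4 n2 (key _ _ _ h1)
  · rw [midpoint_comm, segment_symm] at h1
    exact hcol _ _ _ n4.symm n1.symm n2.symm (key _ _ _ h1)
  · rw [midpoint_comm] at h1
    exact hcol _ _ _ n6 n3.symm n2.symm (key _ _ _ h1)
  · rw [segment_symm] at h1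
    exact hcol _ _ _ n3 n6.symm n2 (key _ _ _ h1)

end Polygon

/-! ### An edge of the convex hull of finitely many points. -/

open scoped RealInnerProductSpace in
/-- Among finitely many points there are two that span an edge of the convex hull: a supporting
hyperplane contains both and otherwise only points on their line. -/
theorem exists_supporting_edge {V : Type*} [Fintype V] (pos : V → Space3)
    (hinj : Function.Injective pos) (hcard : 1 < Fintype.card V) :
    ∃ u v : V, u ≠ v ∧ ∃ g : Space3 →ₗ[ℝ] ℝ, (∀ w, g (pos w) ≤ g (pos u)) ∧
      g (pos v) = g (pos u) ∧
      ∀ w, g (pos w) = g (pos u) → Collinear ℝ {pos u, pos v, pos w} := by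
  classical
  have : Nontrivial V := Fintype.one_lt_card_iff_nontrivial.1 hcard
  obtain ⟨u, hu⟩ := Finite.exists_max (fun w => ‖pos w‖)
  let f : V → ℝ := fun w => ⟪pos u, pos u - pos w⟫
  have hf : ∀ w, w ≠ u → 0 < f w := by
    intro w hw
    have h1 : 0 < ‖pos u - pos w‖ ^ 2 := by
      have : pos u - pos w ≠ 0 := sub_ne_zero.2 fun h => hw (hinj h).symm
      positivity
    rw [norm_sub_sq_real] at h1
    have h2 : ‖pos w‖ ^ 2 ≤ ‖pos u‖ ^ 2 := pow_le_pow_left₀ (norm_nonneg _) (hu w) 2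
    simp only [f, inner_sub_right, real_inner_self_eq_norm_sq]
    linarith
  -- As u is farthest from the origin, `f` is positive off u. Thus `q` projects the other points
  -- centrally from u onto a plane, and v is chosen with the longest projection.
  let q : V → Space3 := fun w => (f w)⁻¹ • (pos w - pos u)
  obtain ⟨v, hv, hmax⟩ := (Finset.univ.erase u).exists_max_image (fun w => ‖q w‖)
    (by obtain ⟨w, hw⟩ := exists_ne u; exact ⟨w, by simp [hw]⟩)
  have hvu : v ≠ u := Finset.ne_of_mem_erase hv
  have hq : ∀ w, w ≠ u → pos w = pos u + f w • q w := by
    intro w hw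
    simp only [q, smul_smul, mul_inv_cancel₀ (hf w hw).ne', one_smul]
    abel
  -- The second summand makes `g (pos w) - g (pos u)` equal to `f w * (⟪q v, q w⟫ - ‖q v‖ ^ 2)`.
  -- This is ≤ 0 by maximality of `‖q v‖`, with equality only for `q w = q v`.
  let g : Space3 →ₗ[ℝ] ℝ :=
    (innerSL ℝ (q v)).toLinearMap + (‖q v‖ ^ 2) • (innerSL ℝ (pos u)).toLinearMap
  have hg : ∀ w, w ≠ u → g (pos w) = g (pos u) + f w * (⟪q v, q w⟫ - ‖q v‖ ^ 2) := by
    intro w hw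
    have h1 : ⟪pos u, q w⟫ = -1 := by
      have : ⟪pos u, pos w - pos u⟫ = - f w := by
        simp only [f, ← inner_neg_right, neg_sub]
      simp only [q, inner_smul_right, this]
      have := (hf w hw).ne'
      field_simp
    nth_rw 1 [hq w hw]
    simp only [g, LinearMap.add_apply, LinearMap.smul_apply, ContinuousLinearMap.coe_coe,
      innerSL_apply_apply, inner_add_right, inner_smul_right, h1, smul_eq_mul]
    ring
  have hcs : ∀ w, w ≠ u → ‖q v - q w‖ ^ 2 ≤ 2 * (‖q v‖ ^ 2 - ⟪q v, q w⟫) := by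
    intro w hw
    have h2 : ‖q w‖ ^ 2 ≤ ‖q v‖ ^ 2 :=
      pow_le_pow_left₀ (norm_nonneg _) (hmax w (by simp [hw])) 2
    rw [norm_sub_sq_real]
    linarith
  refine ⟨u, v, hvu.symm, g, fun w => ?_, ?_, fun w hw => ?_⟩
  · rcases eq_or_ne w u with rfl | hw
    · exact le_rfl
    · rw [hg w hw]
      have := hf w hw
      have := hcs w hw
      have := sq_nonneg ‖q v - q w‖
      nlinarith
  · rw [hg v hvu, real_inner_self_eq_norm_sq]
    ring
  · rcases eq_or_ne w u with rfl | hwu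
    · have : ({pos w, pos v, pos w} : Set Space3) = {pos w, pos v} := by
        ext; simp; tauto
      rw [this]
      exact collinear_pair ℝ _ _
    · rw [hg w hwu] at hw
      have h0 : ⟪q v, q w⟫ - ‖q v‖ ^ 2 = 0 := by
        have : f w * (⟪q v, q w⟫ - ‖q v‖ ^ 2) = 0 := by linarith
        exact (mul_eq_zero.1 this).resolve_left (hf w hwu).ne'
      have h1 := hcs w hwu
      have h2 : ‖q v - q w‖ ^ 2 = 0 := le_antisymm (by linarith) (sq_nonneg _)
      have h3 : q v = q w := by simpa [sub_eq_zero] using h2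
      rw [collinear_iff_of_mem (p₀ := pos u) (by simp)]
      refine ⟨q v, fun p hp => ?_⟩
      simp only [mem_insert_iff, mem_singleton_iff] at hp
      rcases hp with rfl | rfl | rfl
      · exact ⟨0, by simp⟩
      · exact ⟨f v, by rw [vadd_eq_add, add_comm]; exact hq v hvu⟩
      · exact ⟨f w, by rw [vadd_eq_add, add_comm, h3]; exact hq w hwu⟩

/-! ### Counting blocks of a Steiner system. -/

theorem card_filter_powersetCard_superset {V : Type*} [DecidableEq V] {S b : Finset V} {t : ℕ}
    (hS : S ⊆ b) (ht : S.card ≤ t) :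
    ((b.powersetCard t).filter (S ⊆ ·)).card = (b.card - S.card).choose (t - S.card) := by
  rw [← Finset.card_sdiff_of_subset hS, ← Finset.card_powersetCard]
  refine Finset.card_bij' (fun T _ => T \ S) (fun T _ => T ∪ S) ?_ ?_ ?_ ?_
  · intro T hT
    simp only [Finset.mem_filter, Finset.mem_powersetCard] at hT ⊢
    exact ⟨Finset.sdiff_subset_sdiff hT.1.1 le_rfl, by
      rw [Finset.card_sdiff_of_subset hT.2, hT.1.2]⟩
  · intro T hT
    simp only [Finset.mem_filter, Finset.mem_powersetCard] at hT ⊢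
    refine ⟨⟨Finset.union_subset (hT.1.trans Finset.sdiff_subset) hS, ?_⟩,
      Finset.subset_union_right⟩
    rw [Finset.card_union_of_disjoint (Finset.disjoint_of_subset_left hT.1
      Finset.sdiff_disjoint), hT.2]
    lia
  · intro T hT
    simp only [Finset.mem_filter] at hT
    exact Finset.sdiff_union_of_subset hT.2
  · intro T hT
    simp only [Finset.mem_powersetCard] at hT
    exact Finset.union_sdiff_cancel_right
      (Finset.disjoint_of_subset_left hT.1 Finset.sdiff_disjoint)

namespace IsSteinerSystem

variable {V : Type*} {t k : ℕ} {B : Set (Finset V)}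

theorem eq_of_subset (hB : IsSteinerSystem t k B) {T b c : Finset V} (hT : T.card = t)
    (hb : b ∈ B) (hc : c ∈ B) (hTb : T ⊆ b) (hTc : T ⊆ c) : b = c :=
  (hB.2 T hT).unique ⟨hb, hTb⟩ ⟨hc, hTc⟩

/-- The number of blocks that contain a given set `S` of at most `t` points. -/
theorem card_blocks_mul_choose [Fintype V] [DecidableEq V] (hB : IsSteinerSystem t k B)
    {F : Finset (Finset V)} (hF : ∀ b, b ∈ F ↔ b ∈ B) {S : Finset V} (hS : S.card ≤ t) :
    (F.filter (S ⊆ ·)).card * (k - S.card).choose (t - S.card) =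
      (Fintype.card V - S.card).choose (t - S.card) := by
  -- Double count the pairs S ⊆ T ⊆ b with b a block and T a t-set; each T lies in exactly one b.
  have h := Finset.sum_card_bipartiteAbove_eq_sum_card_bipartiteBelow (fun b T : Finset V => T ⊆ b)
    (s := F.filter (S ⊆ ·)) (t := (Finset.univ.powersetCard t).filter (S ⊆ ·))
  rw [Finset.sum_congr rfl (g := fun _ => (k - S.card).choose (t - S.card)),
    Finset.sum_congr (s₂ := (Finset.univ.powersetCard t).filter (S ⊆ ·)) rfl (g := fun _ => 1),
    Finset.sum_const, Finset.sum_const, smul_eq_mul, smul_eq_mul, mul_one,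
    card_filter_powersetCard_superset (Finset.subset_univ S) hS, Finset.card_univ] at h
  · exact h
  · intro T hT
    simp only [Finset.mem_filter, Finset.mem_powersetCard] at hT
    obtain ⟨b, ⟨hb, hTb⟩, huniq⟩ := hB.2 T hT.1.2
    rw [Finset.card_eq_one]
    refine ⟨b, ?_⟩
    ext c
    simp only [Finset.mem_bipartiteBelow, Finset.mem_filter, hF, Finset.mem_singleton]
    exact ⟨fun hc => huniq c ⟨hc.1.1, hc.2⟩,
      fun hc => hc ▸ ⟨⟨hb, hT.2.trans hTb⟩, hTb⟩⟩
  · intro b hb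
    simp only [Finset.mem_filter, hF] at hb
    rw [← hB.1 b hb.1, ← card_filter_powersetCard_superset hb.2 hS]
    congr 1
    ext T
    simp only [Finset.mem_bipartiteAbove, Finset.mem_filter, Finset.mem_powersetCard]
    constructor
    · rintro ⟨⟨⟨-, h1⟩, h2⟩, h3⟩; exact ⟨⟨h3, h1⟩, h2⟩
    · rintro ⟨⟨h3, h1⟩, h2⟩; exact ⟨⟨⟨Finset.subset_univ _, h1⟩, h2⟩, h3⟩

end IsSteinerSystem

/-! ### Diagonals in non-crossing drawings. -/

namespace IsNoncrossingDrawing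

variable {V : Type*} {B : Set (Finset V)} {pos : V → Space3} {poly : Finset V → Polygon Space3 4}

theorem exists_pos_eq (h : IsNoncrossingDrawing B pos poly) {e : Finset V} (he : e ∈ B)
    (i : Fin 4) : ∃ v ∈ e, pos v = poly e i := by
  have : poly e i ∈ pos '' (e : Set V) := by
    rw [← h.corners e he]
    exact mem_range_self i
  exact this

theorem exists_vertex_eq (h : IsNoncrossingDrawing B pos poly) {e : Finset V} (he : e ∈ B)
    {v : V} (hv : v ∈ e) : ∃ i, poly e i = pos v := by
  have : pos v ∈ range (poly e).vertices := by
    rw [h.corners e he]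
    exact mem_image_of_mem pos hv
  exact this

theorem eq_of_mem_openRegion (h : IsNoncrossingDrawing B pos poly) {e f : Finset V} (he : e ∈ B)
    (hf : f ∈ B) {x : Space3} (hxe : x ∈ (poly e).openRegion) (hxf : x ∈ (poly f).openRegion) :
    e = f := by
  by_contra hne
  exact Set.disjoint_left.1 (h.disjoint e he f hf hne) hxe hxf

/-- Assigning to every block an inner diagonal is injective. -/
theorem card_le_choose_two [Fintype V] (h : IsNoncrossingDrawing B pos poly)
    {F : Finset (Finset V)} (hF : ∀ b, b ∈ F ↔ b ∈ B) :
    F.card ≤ (Fintype.card V).choose 2 := by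
  classical
  rw [← Finset.card_univ, ← Finset.card_powersetCard]
  refine Finset.card_le_card_of_forall_subsingleton (fun e (T : Finset V) => ∃ u v : V,
    T = {u, v} ∧ midpoint ℝ (pos u) (pos v) ∈ (poly e).openRegion) ?_ ?_
  · intro e he
    rw [hF] at he
    obtain ⟨i, hi⟩ := (h.simple e he).exists_midpoint_mem_openRegion
    obtain ⟨u, -, hu⟩ := h.exists_pos_eq he i
    obtain ⟨v, -, hv⟩ := h.exists_pos_eq he (i + 2)
    have hne : u ≠ v := by
      rintro rfl
      have h2 : ∀ i : Fin 4, i ≠ i + 2 := by decide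
      exact h2 i ((h.simple e he).injective (hu.symm.trans hv))
    exact ⟨{u, v}, by simp [Finset.card_pair hne], u, v, rfl, by rwa [hu, hv]⟩
  · rintro T - e ⟨he, u, v, hT, hm⟩ f ⟨hf, u', v', hT', hm'⟩
    rw [hF] at he hf
    refine h.eq_of_mem_openRegion he hf hm ?_
    have : ({u, v} : Set V) = {u', v'} := by
      have := congrArg (fun s : Finset V => (s : Set V)) (hT.symm.trans hT')
      simpa using this
    rcases Set.pair_eq_pair_iff.1 this with ⟨rfl, rfl⟩ | ⟨rfl, rfl⟩
    · exact hm'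
    · rwa [midpoint_comm]

/-- In a drawing by convex quadrilaterals of a Steiner quadruple system with more than one block,
no three vertices are collinear. -/
theorem not_collinear_of_isConvex [Fintype V] (hB : IsSteinerSystem 3 4 B)
    (h : IsNoncrossingDrawing B pos poly) (hconv : ∀ e ∈ B, (poly e).IsConvex)
    (hcard : 4 < Fintype.card V) {x y z : V} (hxy : x ≠ y) (hyz : y ≠ z) (hxz : x ≠ z) :
    ¬ Collinear ℝ {pos x, pos y, pos z} := by
  classical
  have key : ∀ x y z : V, x ≠ y → y ≠ z → x ≠ z → ¬ Wbtw ℝ (pos x) (pos y) (pos z) := by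
    intro x y z hxy hyz hxz hw
    have hT : ({x, y, z} : Finset V).card = 3 := Finset.card_eq_three.2 ⟨x, y, z, hxy, hxz, hyz, rfl⟩
    obtain ⟨e, ⟨he, hTe⟩, -⟩ := hB.2 _ hT
    obtain ⟨w, hw'⟩ : ∃ w, w ∉ e := by
      by_contra! hall
      have := hB.1 e he
      rw [Finset.eq_univ_of_forall hall, Finset.card_univ] at this
      lia
    have hxe : x ∈ e := hTe (by simp)
    have hye : y ∈ e := hTe (by simp)
    have hze : z ∈ e := hTe (by simp)
    -- The block f through x, z and w ∉ e contains y in its convex closed region, so y is a corner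
    -- of f. Then e and f share x, y, z and coincide, contradicting w ∉ e.
    have hT' : ({x, z, w} : Finset V).card = 3 :=
      Finset.card_eq_three.2 ⟨x, z, w, hxz, fun h => hw' (h ▸ hxe), fun h => hw' (h ▸ hze), rfl⟩
    obtain ⟨f, ⟨hf, hTf⟩, -⟩ := hB.2 _ hT'
    have hxf : x ∈ f := hTf (by simp)
    have hzf : z ∈ f := hTf (by simp)
    have hwf : w ∈ f := hTf (by simp)
    have hcl : ∀ v ∈ f, pos v ∈ (poly f).closedRegion := by
      intro v hv
      obtain ⟨i, hi⟩ := h.exists_vertex_eq hf hv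
      rw [← hi]
      exact Or.inr (Polygon.mem_boundary_vertex _ _)
    have hyf : y ∈ f := by
      refine h.corner_mem f hf e he y hye ?_
      exact (hconv f hf).segment_subset (hcl x hxf) (hcl z hzf)
        (by rwa [← affineSegment_eq_segment])
    have : e = f := by
      refine hB.eq_of_subset hT he hf hTe ?_
      intro v hv
      simp only [Finset.mem_insert, Finset.mem_singleton] at hv
      rcases hv with rfl | rfl | rfl <;> assumption
    exact hw' (this ▸ hwf)
  intro hcol
  rcases hcol.wbtw_or_wbtw_or_wbtw with hw | hw | hw
  · exact key _ _ _ hxy hyz hxz hw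
  · exact key _ _ _ hyz hxz.symm hxy.symm hw
  · exact key _ _ _ hxz.symm hxy hyz.symm hw

/-- In a drawing by convex quadrilaterals, the diagonals at an end of an edge of the convex hull
of the vertices avoid the other end. -/
theorem exists_card_filter_le [Fintype V] [DecidableEq V] (hB : IsSteinerSystem 3 4 B)
    (h : IsNoncrossingDrawing B pos poly) (hconv : ∀ e ∈ B, (poly e).IsConvex)
    (hcard : 4 < Fintype.card V) {F : Finset (Finset V)} (hF : ∀ b, b ∈ F ↔ b ∈ B) :
    ∃ u : V, (F.filter ({u} ⊆ ·)).card ≤ Fintype.card V - 2 := by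
  obtain ⟨u, v, huv, g, hle, hgv, hg⟩ := exists_supporting_edge pos h.pos_injective (by lia)
  have hncol {x y z : V} := h.not_collinear_of_isConvex hB hconv hcard (x := x) (y := y) (z := z)
  refine ⟨u, ?_⟩
  have hc : ((Finset.univ : Finset V) \ {u, v}).card = Fintype.card V - 2 := by
    rw [Finset.card_sdiff_of_subset (Finset.subset_univ _), Finset.card_pair huv, Finset.card_univ]
  rw [← hc]
  -- A block through u is matched with its corner opposite to u.
  refine Finset.card_le_card_of_forall_subsingleton
    (fun e w => midpoint ℝ (pos u) (pos w) ∈ (poly e).openRegion) ?_ ?_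
  · intro e he
    simp only [Finset.mem_filter, hF, Finset.singleton_subset_iff] at he
    obtain ⟨he, hue⟩ := he
    have hs := h.simple e he
    obtain ⟨i, hi⟩ := h.exists_vertex_eq he hue
    obtain ⟨w, hwe, hw⟩ := h.exists_pos_eq he (i + 2)
    obtain ⟨x, hxe, hx⟩ := h.exists_pos_eq he (i + 1)
    have hij : ∀ i : Fin 4, i ≠ i + 2 ∧ i + 1 ≠ i ∧ i + 1 ≠ i + 2 := by decide
    obtain ⟨n1, n2, n3⟩ := hij i
    have hm : midpoint ℝ (poly e i) (poly e (i + 2)) ∈ (poly e).openRegion := by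
      refine (hconv e he).midpoint_mem_openRegion ?_ i
      intro a b c hab hbc hac
      obtain ⟨a', -, ha⟩ := h.exists_pos_eq he a
      obtain ⟨b', -, hb⟩ := h.exists_pos_eq he b
      obtain ⟨c', -, hc⟩ := h.exists_pos_eq he c
      rw [← ha, ← hb, ← hc]
      apply hncol
      · rintro rfl; exact hab (hs.injective (ha.symm.trans hb))
      · rintro rfl; exact hbc (hs.injective (hb.symm.trans hc))
      · rintro rfl; exact hac (hs.injective (ha.symm.trans hc))
    refine ⟨w, ?_, by rwa [hi, ← hw] at hm⟩
    simp only [Finset.mem_sdiff, Finset.mem_univ, true_and, Finset.mem_insert,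
      Finset.mem_singleton, not_or]
    constructor
    · rintro rfl
      exact n1 (hs.injective (hi.trans hw))
    · rintro rfl
      have hxu : x ≠ u := by rintro rfl; exact n2 (hs.injective (hx.symm.trans hi.symm))
      have hxw : x ≠ w := by rintro rfl; exact n3 (hs.injective (hx.symm.trans hw))
      -- Here the opposite corner is v itself. The corner x next to u is strictly below the
      -- supporting plane, since otherwise u, v, x would be collinear.
      refine Polygon.midpoint_notMem_openRegion g (M := g (pos u)) (j := i + 1) ?_ (by rw [hi])
        (by rw [← hw, hgv]) ?_ hm
      · intro j
        obtain ⟨y, -, hy⟩ := h.exists_pos_eq he j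
        rw [← hy]
        exact hle y
      · rw [← hx]
        refine lt_of_le_of_ne (hle x) fun he => ?_
        exact hncol huv hxw.symm hxu.symm (hg x he)
  · rintro w - e ⟨he, hm⟩ f ⟨hf, hm'⟩
    simp only [Finset.mem_filter, hF] at he hf
    exact h.eq_of_mem_openRegion he.1 hf.1 hm hm'

end IsNoncrossingDrawing

/-! ### The two numerical contradictions. -/

theorem theorem7 {V : Type*} [Fintype V] (B : Set (Finset V)) (hB : IsSteinerSystem 3 4 B) :
    (4 < Fintype.card V →
      ¬ ∃ (pos : V → Space3) (poly : Finset V → Polygon Space3 4),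
        IsNoncrossingDrawing B pos poly ∧ ∀ e ∈ B, (poly e).IsConvex) ∧
    (20 ≤ Fintype.card V →
      ¬ ∃ (pos : V → Space3) (poly : Finset V → Polygon Space3 4),
        IsNoncrossingDrawing B pos poly) := by
  classical
  obtain ⟨F, hF⟩ : ∃ F : Finset (Finset V), ∀ b, b ∈ F ↔ b ∈ B :=
    ⟨B.toFinite.toFinset, fun b => by simp⟩
  constructor
  · rintro hcard ⟨pos, poly, h, hconv⟩
    obtain ⟨u, hu⟩ := h.exists_card_filter_le hB hconv hcard hF
    have h1 := hB.card_blocks_mul_choose hF (S := {u}) (by simp)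
    have : Nontrivial V := Fintype.one_lt_card_iff_nontrivial.1 (by lia)
    obtain ⟨v, hv⟩ := exists_ne u
    have h2 := hB.card_blocks_mul_choose hF (S := {v, u}) (by rw [Finset.card_pair hv]; norm_num)
    rw [Finset.card_pair hv] at h2
    rw [Finset.card_singleton] at h1
    generalize (F.filter ({v, u} ⊆ ·)).card = s at h2
    generalize (F.filter ({u} ⊆ ·)).card = r at *
    generalize Fintype.card V = n at *
    obtain ⟨k, rfl⟩ : ∃ k, n = k + 2 := ⟨n - 2, by lia⟩
    have h3 := Nat.choose_succ_right_eq (k + 1) 1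
    simp only [Nat.choose_one_right, Nat.add_sub_cancel, show (4 - 1).choose (3 - 1) = 3 by rfl,
      show k + 2 - 1 = k + 1 by lia, show 3 - 1 = 2 by rfl, show 1 + 1 = 2 by rfl,
      show (4 - 2).choose (3 - 2) = 2 by rfl, show 3 - 2 = 1 by rfl] at h1 h2 h3 hu
    rw [← h1] at h3
    -- With n = k + 2, the counts give 6r = (k+1)k and r ≤ k. Of the remaining k > 2, 3 and 5
    -- violate 2s = k, and 4 would need 3r = 10.
    have hk : k ≤ 5 := by nlinarith
    interval_cases k <;> lia
  · rintro hcard ⟨pos, poly, h⟩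
    have h1 := h.card_le_choose_two hF
    have h2 := hB.card_blocks_mul_choose hF (S := ∅) (by simp)
    simp only [Finset.empty_subset, Finset.filter_true, Finset.card_empty, Nat.sub_zero] at h2
    generalize Fintype.card V = n at *
    generalize F.card = m at *
    have h3 := Nat.choose_succ_right_eq n 2
    simp only [show 2 + 1 = 3 by rfl, ← h2, show Nat.choose 4 3 = 4 by rfl] at h3
    have hpos : 0 < n.choose 2 := Nat.choose_pos (by lia)
    obtain ⟨k, rfl⟩ : ∃ k, n = k + 20 := ⟨n - 20, by lia⟩
    rw [show k + 20 - 2 = k + 18 by lia] at h3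
    -- From 12m = C(n,2)(n-2) and m ≤ C(n,2) follows n - 2 ≤ 12.
    nlinarith
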